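/- Let $n,m_1,m_2$ be non-negative integers, $m=m_1+m_2$, and let $j=\mathrm{diag}(I_{m_1},-I_{m_2})$. Let $\{\alpha,S_0,\vartheta_1,\vartheta_2\}$ be a strongly admissible quadruple of complex matrices: $\alpha,S_0$ are $n\times n$, $\vartheta_1$ is $n\times m_1$, $\vartheta_2$ is $n\times m_2$, the matrix $S_0$ is positive definite, $\alpha S_0-S_0\alpha^*=i(\vartheta_1\vartheta_1^*+\vartheta_2\vartheta_2^*)$, and the pair $\{\alpha,\vartheta_1\}$ is controllable, i.e. $\mathrm{Span}\bigcup_{\nu=0}^{n-1}\mathrm{Im}(\alpha^\nu\vartheta_1)=\mathbb C^n$. For $k\ge 0$ put $$\Lambda_0=\begin{bmatrix}\vartheta_1&\vartheta_2\end{bmatrix},\quad \Lambda_{k+1}=\Lambda_k+i\alpha^{-1}\Lambda_kj,\quad S_{k+1}=S_k+\alpha^{-1}S_k(\alpha^{-1})^*+\alpha^{-1}\Lambda_kj\Lambda_k^*(\alpha^{-1})^*,$$ $$C_k=j+\Lambda_k^*S_k^{-1}\Lambda_k-\Lambda_{k+1}^*S_{k+1}^{-1}\Lambda_{k+1}.$$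 Then $\alpha$ is invertible, all $S_k$ are positive definite, and $\{C_k\}$ (the pseudo-exponential potential generated by the quadruple) is the potential of a discrete skew-selfadjoint Dirac system $$y_{k+1}(z)=(I_m+iz^{-1}C_k)\,y_k(z),\qquad C_k=U_k^*jU_k\ \text{ with } U_k \text{ unitary}\qquad(k\ge 0).$$ Let $w_k(z)$ be the fundamental solution of this system normalized by $w_0(z)\equiv I_m$. A Weyl function of the system is an $m_1\times m_2$ matrix function $\psi$ that is meromorphic on a half-plane $\{\Im z>M\}$, for some $M>0$, and satisfies $$\sum_{k=0}^\infty\begin{bmatrix}\psi(z)^*&I_{m_2}\end{bmatrix}w_k(z)^*w_k(z)\begin{bmatrix}\psi(z)\\ I_{m_2}\end{bmatrix}<\infty \qquad (*)$$ at every point $z$ of this half-plane where $\psi$ is analytic. The system has a unique Weyl function, namely $$\varphi(z)=-i\,\vartheta_1^*S_0^{-1}(zI_n+\beta)^{-1}\vartheta_2,\qquad \beta=\alpha-i\,\vartheta_2\vartheta_2^*S_0^{-1}.$$ That is, $\varphi$ is a Weyl function on some half-plane $\{\Im z>M\}$, $M>0$, and every Weyl function on any half-plane $\{\Im z>M\}$,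 $M>0$, coincides there with $\varphi$ as a meromorphic function. Moreover, $\varphi$ is defined and satisfies $(*)$ for all $z$ with $\Im z>\frac12$, apart from finitely many points. -/

import Mathlib

open scoped Matrix ComplexOrder

noncomputable section

namespace SkewDirac

/-- The signature matrix `j = diag(I_{m₁}, -I_{m₂})`. -/
def signature (m₁ m₂ : ℕ) : Matrix (Fin m₁ ⊕ Fin m₂) (Fin m₁ ⊕ Fin m₂) ℂ :=
  Matrix.fromBlocks 1 0 0 (-1)

/-- A sequence is the potential of a discrete skew-selfadjoint Dirac system
`y_{k+1}(z) = (I + i z⁻¹ C_k) y_k(z)` if `C_k = U_k* j U_k` with unitary `U_k`. -/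
def IsDiracPotential {m₁ m₂ : ℕ}
    (C : ℕ → Matrix (Fin m₁ ⊕ Fin m₂) (Fin m₁ ⊕ Fin m₂) ℂ) : Prop :=
  ∀ k, ∃ U ∈ Matrix.unitaryGroup (Fin m₁ ⊕ Fin m₂) ℂ, C k = Uᴴ * signature m₁ m₂ * U

/-- The fundamental solution `w_k(z)` of the system with potential `C`, normalized by
`w_0(z) = I`. -/
def fundSol {m₁ m₂ : ℕ} (C : ℕ → Matrix (Fin m₁ ⊕ Fin m₂) (Fin m₁ ⊕ Fin m₂) ℂ) (z : ℂ) :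
    ℕ → Matrix (Fin m₁ ⊕ Fin m₂) (Fin m₁ ⊕ Fin m₂) ℂ
  | 0 => 1
  | k + 1 => (1 + (Complex.I * z⁻¹) • C k) * fundSol C z k

/-- The summability condition at the point `z` for the value `V` (to be taken by a Weyl function):
`∑_k [V* I] w_k(z)* w_k(z) [V; I] < ∞`. -/
def WeylSummable {m₁ m₂ : ℕ} (C : ℕ → Matrix (Fin m₁ ⊕ Fin m₂) (Fin m₁ ⊕ Fin m₂) ℂ) (z : ℂ)
    (V : Matrix (Fin m₁) (Fin m₂) ℂ) : Prop :=
  Summable fun k : ℕ =>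
    Matrix.fromCols Vᴴ (1 : Matrix (Fin m₂) (Fin m₂) ℂ) * (fundSol C z k)ᴴ * fundSol C z k *
      Matrix.fromRows V (1 : Matrix (Fin m₂) (Fin m₂) ℂ)

/-- The matrix function `ψ` is analytic at `z`, entry by entry. -/
def RegularAt {m₁ m₂ : ℕ} (ψ : ℂ → Matrix (Fin m₁) (Fin m₂) ℂ) (z : ℂ) : Prop :=
  ∀ i j, AnalyticAt ℂ (fun w => ψ w i j) z

/-- `ψ` is a Weyl function, on the half-plane `Im z > M` with `M > 0`, of the system with
potential `C`: it is meromorphic there and satisfies the summability condition at all points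
of the half-plane where it is analytic. (A meromorphic function has no meaningful value at its
poles.) -/
def IsWeylFunctionOn {m₁ m₂ : ℕ} (C : ℕ → Matrix (Fin m₁ ⊕ Fin m₂) (Fin m₁ ⊕ Fin m₂) ℂ)
    (M : ℝ) (ψ : ℂ → Matrix (Fin m₁) (Fin m₂) ℂ) : Prop :=
  0 < M ∧ (∀ i j, MeromorphicOn (fun w => ψ w i j) {z : ℂ | M < z.im}) ∧
    ∀ z : ℂ, M < z.im → RegularAt ψ z → WeylSummable C z (ψ z)

/-- A quadruple of matrices `{α, S₀, ϑ₁, ϑ₂}` (data only). -/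
structure Quadruple (n m₁ m₂ : ℕ) where
  α : Matrix (Fin n) (Fin n) ℂ
  S₀ : Matrix (Fin n) (Fin n) ℂ
  ϑ₁ : Matrix (Fin n) (Fin m₁) ℂ
  ϑ₂ : Matrix (Fin n) (Fin m₂) ℂ

/-- The pair `{A, B}` is controllable: the images of `A^ν B`, `0 ≤ ν ≤ n - 1`, span `ℂⁿ`. -/
def Controllable {n m : ℕ} (A : Matrix (Fin n) (Fin n) ℂ) (B : Matrix (Fin n) (Fin m) ℂ) : Prop :=
  (⨆ ν : Fin n, LinearMap.range (A ^ (ν : ℕ) * B).mulVecLin) = ⊤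

namespace Quadruple

variable {n m₁ m₂ : ℕ}

/-- Admissibility: `S₀ > 0` and `α S₀ - S₀ α* = i (ϑ₁ ϑ₁* + ϑ₂ ϑ₂*)`. -/
def Admissible (Q : Quadruple n m₁ m₂) : Prop :=
  Q.S₀.PosDef ∧
    Q.α * Q.S₀ - Q.S₀ * Q.αᴴ = Complex.I • (Q.ϑ₁ * Q.ϑ₁ᴴ + Q.ϑ₂ * Q.ϑ₂ᴴ)

/-- Strong admissibility: admissibility and controllability of the pair `{α, ϑ₁}`. -/
def StronglyAdmissible (Q : Quadruple n m₁ m₂) : Prop :=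
  Q.Admissible ∧ Controllable Q.α Q.ϑ₁

/-- `Λ_0 = [ϑ₁ ϑ₂]`, `Λ_{k+1} = Λ_k + i α⁻¹ Λ_k j`. -/
def Λ (Q : Quadruple n m₁ m₂) : ℕ → Matrix (Fin n) (Fin m₁ ⊕ Fin m₂) ℂ
  | 0 => Matrix.fromCols Q.ϑ₁ Q.ϑ₂
  | k + 1 => Q.Λ k + Complex.I • (Q.α⁻¹ * Q.Λ k * signature m₁ m₂)

/-- `S_{k+1} = S_k + α⁻¹ S_k α^{-*} + α⁻¹ Λ_k j Λ_k* α^{-*}`. -/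
def S (Q : Quadruple n m₁ m₂) : ℕ → Matrix (Fin n) (Fin n) ℂ
  | 0 => Q.S₀
  | k + 1 => Q.S k + Q.α⁻¹ * Q.S k * (Q.α⁻¹)ᴴ +
      Q.α⁻¹ * Q.Λ k * signature m₁ m₂ * (Q.Λ k)ᴴ * (Q.α⁻¹)ᴴ

/-- The pseudo-exponential potential
`C_k = j + Λ_k* S_k⁻¹ Λ_k - Λ_{k+1}* S_{k+1}⁻¹ Λ_{k+1}`. -/
def potential (Q : Quadruple n m₁ m₂) (k : ℕ) :
    Matrix (Fin m₁ ⊕ Fin m₂) (Fin m₁ ⊕ Fin m₂) ℂ :=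
  signature m₁ m₂ + (Q.Λ k)ᴴ * (Q.S k)⁻¹ * Q.Λ k -
    (Q.Λ (k + 1))ᴴ * (Q.S (k + 1))⁻¹ * Q.Λ (k + 1)

/-- `β = α - i ϑ₂ ϑ₂* S₀⁻¹`. -/
def β (Q : Quadruple n m₁ m₂) : Matrix (Fin n) (Fin n) ℂ :=
  Q.α - Complex.I • (Q.ϑ₂ * Q.ϑ₂ᴴ * Q.S₀⁻¹)

/-- `φ(z) = -i ϑ₁* S₀⁻¹ (z I + β)⁻¹ ϑ₂`. -/
def φ (Q : Quadruple n m₁ m₂) (z : ℂ) : Matrix (Fin m₁) (Fin m₂) ℂ :=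
  (-Complex.I) • (Q.ϑ₁ᴴ * Q.S₀⁻¹ * (z • (1 : Matrix (Fin n) (Fin n) ℂ) + Q.β)⁻¹ * Q.ϑ₂)

end Quadruple

end SkewDirac

end

noncomputable section

/-! ### Controllability, the spectrum of `α`, the operator identity and the positivity of `S_k`. -/

namespace SkewDirac

section Signature

variable {m₁ m₂ : ℕ}

/-! The system is a Darboux transform of the trivial one with `C_k = j`. The transfer functions
`W_k(z)` (`transfer`) satisfy `(z + i C_k) W_k(z) = W_{k+1}(z) (z + i j)` (`darboux`), hence `w_k(z)
W_0(z) = W_k(z) (1 + i z⁻¹ j)^k` (`fundSol_mul_transfer`). The matrices `W_k(0)` are unitary, so the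
Hermitian `C_k` is an involution. Its trace is that of `j`, because `tr (Λ_k* S_k⁻¹ Λ_k) = 2 Im tr
α` for every `k` (`trace_eq`), and therefore `C_k` is unitarily equivalent to `j`.

For the Weyl function, `|1 - i/z| < 1` when `Im z > 1/2`, while `|1 + i/z| ≥ 1` in the upper
half-plane. Since the `W_k(z)` are contractive there, every initial value `W_0 [0; G]` gives a
geometrically decaying solution, and normalizing its lower block to `I` yields `[φ; I]`. Conversely,
for `Im z ≥ 4 Im tr α` the `W_k(z)` are bounded below uniformly in `k`, so summability annihilates
the upper block of `W_0⁻¹ [ψ; I]` and forces `ψ = φ`. The identity theorem carries this equality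
down the half-plane.

Both bounds on `W_k` come from one energy balance (`exists_energy_balance`), and the uniformity in
`k` from the constant trace. -/

theorem signature_conjTranspose : (signature m₁ m₂)ᴴ = signature m₁ m₂ := by
  simp [signature, Matrix.fromBlocks_conjTranspose]

theorem signature_mul_self : signature m₁ m₂ * signature m₁ m₂ = 1 := by
  simp [signature, Matrix.fromBlocks_multiply]

/-- The orthogonal projection of `ℂ^{m₁} ⊕ ℂ^{m₂}` onto the first summand. -/
def firstProj (m₁ m₂ : ℕ) : Matrix (Fin m₁ ⊕ Fin m₂) (Fin m₁ ⊕ Fin m₂) ℂ :=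
  Matrix.fromBlocks 1 0 0 0

theorem firstProj_conjTranspose : (firstProj m₁ m₂)ᴴ = firstProj m₁ m₂ := by
  simp [firstProj, Matrix.fromBlocks_conjTranspose]

theorem firstProj_mul_self : firstProj m₁ m₂ * firstProj m₁ m₂ = firstProj m₁ m₂ := by
  simp [firstProj, Matrix.fromBlocks_multiply]

theorem signature_mul_firstProj : signature m₁ m₂ * firstProj m₁ m₂ = firstProj m₁ m₂ := by
  simp [firstProj, signature, Matrix.fromBlocks_multiply]

theorem signature_eq : signature m₁ m₂ = (2 : ℂ) • firstProj m₁ m₂ - 1 := by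
  ext (i | i) (k | k)
  · by_cases h : i = k <;> norm_num [firstProj, signature, Matrix.one_apply, h]
  all_goals simp [firstProj, signature, Matrix.one_apply]

end Signature

/-- A left eigenvector of `A` that is orthogonal to the image of `B` vanishes if the pair `{A, B}`
is controllable. -/
theorem Controllable.eq_zero_of_left_eigenvector {n m : ℕ} {A : Matrix (Fin n) (Fin n) ℂ}
    {B : Matrix (Fin n) (Fin m) ℂ} (h : Controllable A B) {v : Fin n → ℂ} {c : ℂ}
    (hA : v ᵥ* A = c • v) (hB : v ᵥ* B = 0) : v = 0 := by
  have hpow : ∀ ν : ℕ, v ᵥ* (A ^ ν) = c ^ ν • v := by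
    intro ν
    induction ν with
    | zero => simp
    | succ ν ih =>
      rw [pow_succ, ← Matrix.vecMul_vecMul, ih, Matrix.smul_vecMul, hA, smul_smul, pow_succ]
  have hle : (⨆ ν : Fin n, LinearMap.range (A ^ (ν : ℕ) * B).mulVecLin) ≤
      LinearMap.ker (dotProductBilin ℂ ℂ v) := by
    refine iSup_le fun ν => ?_
    rintro _ ⟨x, rfl⟩
    simp [Matrix.dotProduct_mulVec, ← Matrix.vecMul_vecMul, hpow, Matrix.smul_vecMul, hB]
  rw [h, top_le_iff] at hle
  -- Pairing `v` with its own conjugate gives the squared norm of `v`.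
  have : star v ∈ LinearMap.ker (dotProductBilin ℂ ℂ v) := by rw [hle]; trivial
  simpa using this

namespace Quadruple

variable {n m₁ m₂ : ℕ} {Q : Quadruple n m₁ m₂}

theorem Λ_zero_mul_conjTranspose :
    Q.Λ 0 * (Q.Λ 0)ᴴ = Q.ϑ₁ * Q.ϑ₁ᴴ + Q.ϑ₂ * Q.ϑ₂ᴴ := by
  simp [Λ, Matrix.conjTranspose_fromCols_eq_fromRows_conjTranspose, Matrix.fromCols_mul_fromRows]

/-- The spectrum of `α` lies in the open upper half-plane. -/
theorem StronglyAdmissible.isUnit_add (hQ : Q.StronglyAdmissible) {z : ℂ} (hz : 0 ≤ z.im) :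
    IsUnit (z • (1 : Matrix (Fin n) (Fin n) ℂ) + Q.α) := by
  obtain ⟨⟨hS, hid⟩, hc⟩ := hQ
  rw [Matrix.isUnit_iff_isUnit_det, isUnit_iff_ne_zero]
  intro hdet
  obtain ⟨v, hv, hvz⟩ := Matrix.exists_vecMul_eq_zero_iff.2 hdet
  apply hv
  have hα : v ᵥ* Q.α = (-z) • v := by
    rw [Matrix.vecMul_add, Matrix.vecMul_smul, Matrix.vecMul_one] at hvz
    rw [neg_smul]; exact eq_neg_of_add_eq_zero_right hvz
  have hα' : Q.αᴴ *ᵥ star v = (-star z) • star v := by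
    rw [← Matrix.star_vecMul, hα, star_smul, star_neg]
  -- Between `v` and its adjoint the identity reads `-2 Im z · (v S₀ v*) = |v ϑ₁|² + |v ϑ₂|²`. For
  -- `Im z ≥ 0` the signs force `v ϑ₁ = 0`, which contradicts controllability.
  have key := congrArg (fun M => v ⬝ᵥ M *ᵥ star v) hid
  have e1 : v ⬝ᵥ (Q.α * Q.S₀ - Q.S₀ * Q.αᴴ) *ᵥ star v
      = (star z - z) * (v ⬝ᵥ Q.S₀ *ᵥ star v) := by
    rw [Matrix.sub_mulVec, ← Matrix.mulVec_mulVec, ← Matrix.mulVec_mulVec, hα', dotProduct_sub,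
      Matrix.dotProduct_mulVec v Q.α, hα, Matrix.mulVec_smul, dotProduct_smul, smul_dotProduct]
    simp only [smul_eq_mul]; ring
  have e2 : ∀ {p : ℕ} (B : Matrix (Fin n) (Fin p) ℂ),
      v ⬝ᵥ (B * Bᴴ) *ᵥ star v = (v ᵥ* B) ⬝ᵥ star (v ᵥ* B) := by
    intro p B
    rw [← Matrix.mulVec_mulVec, Matrix.dotProduct_mulVec, Matrix.star_vecMul]
  beta_reduce at key
  rw [e1, Matrix.smul_mulVec, Matrix.add_mulVec, dotProduct_smul, dotProduct_add, e2, e2] at key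
  have hpos : 0 < v ⬝ᵥ Q.S₀ *ᵥ star v := by
    have := hS.dotProduct_mulVec_pos (x := star v) (by simpa using hv)
    simpa using this
  have h1 : 0 ≤ (v ᵥ* Q.ϑ₁) ⬝ᵥ star (v ᵥ* Q.ϑ₁) := dotProduct_self_star_nonneg _
  have h2 : 0 ≤ (v ᵥ* Q.ϑ₂) ⬝ᵥ star (v ᵥ* Q.ϑ₂) := dotProduct_self_star_nonneg _
  have h0 : (v ᵥ* Q.ϑ₁) ⬝ᵥ star (v ᵥ* Q.ϑ₁) = 0 := by
    rw [Complex.lt_def] at hpos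
    rw [Complex.le_def] at h1 h2
    have := congrArg Complex.im key
    simp at this hpos h1 h2
    have hp : 0 ≤ z.im * (v ⬝ᵥ Q.S₀ *ᵥ star v).re := mul_nonneg hz hpos.1.le
    apply Complex.ext
    · simp; nlinarith
    · simp [← h1.2]
  exact hc.eq_zero_of_left_eigenvector hα (by simpa using h0)

theorem StronglyAdmissible.isUnit_α (hQ : Q.StronglyAdmissible) : IsUnit Q.α := by
  simpa using hQ.isUnit_add (z := 0) le_rfl

theorem α_mul_inv (h : IsUnit Q.α) : Q.α * Q.α⁻¹ = 1 :=
  Matrix.mul_nonsing_inv _ ((Matrix.isUnit_iff_isUnit_det _).1 h)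

theorem inv_mul_α (h : IsUnit Q.α) : Q.α⁻¹ * Q.α = 1 :=
  Matrix.nonsing_inv_mul _ ((Matrix.isUnit_iff_isUnit_det _).1 h)

/-- The operator identity `α S_k - S_k α* = i Λ_k Λ_k*`. -/
theorem StronglyAdmissible.identity (hQ : Q.StronglyAdmissible) (k : ℕ) :
    Q.α * Q.S k - Q.S k * Q.αᴴ = Complex.I • (Q.Λ k * (Q.Λ k)ᴴ) := by
  induction k with
  | zero => rw [Λ_zero_mul_conjTranspose]; exact hQ.1.2
  | succ k ih =>
    have h1 := α_mul_inv hQ.isUnit_α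
    have h2 := inv_mul_α hQ.isUnit_α
    simp only [S, Λ]
    generalize Q.S k = S at ih ⊢
    generalize Q.Λ k = L at ih ⊢
    generalize Q.α⁻¹ = A at *
    have h3 : Aᴴ * Q.αᴴ = 1 := by rw [← Matrix.conjTranspose_mul, h1, Matrix.conjTranspose_one]
    have h4 : Q.αᴴ * Aᴴ = 1 := by rw [← Matrix.conjTranspose_mul, h2, Matrix.conjTranspose_one]
    have c1 : ∀ {p : ℕ} (X : Matrix (Fin n) (Fin p) ℂ), Q.α * (A * X) = X := fun X => by
      rw [← Matrix.mul_assoc, h1, Matrix.one_mul]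
    have c2 : ∀ {p : ℕ} (X : Matrix (Fin n) (Fin p) ℂ), A * (Q.α * X) = X := fun X => by
      rw [← Matrix.mul_assoc, h2, Matrix.one_mul]
    have hj : ∀ {p : ℕ} (X : Matrix (Fin m₁ ⊕ Fin m₂) (Fin p) ℂ),
        signature m₁ m₂ * (signature m₁ m₂ * X) = X := fun X => by
      rw [← Matrix.mul_assoc, signature_mul_self, Matrix.one_mul]
    -- The identity for `k + 1` is the one for `k` plus its conjugate by `α⁻¹`; the mixed terms with
    -- `j` agree on both sides.
    have ih2 := congrArg (fun M => A * M * Aᴴ) ih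
    simp only [Matrix.mul_add, Matrix.add_mul, Matrix.mul_sub, Matrix.sub_mul, Matrix.mul_assoc,
      Matrix.conjTranspose_add, Matrix.conjTranspose_smul, Matrix.conjTranspose_mul,
      Matrix.mul_smul, Matrix.smul_mul, c1, c2, h3, h4, Matrix.mul_one, hj,
      signature_conjTranspose, smul_add, smul_smul, Complex.star_def, Complex.conj_I] at ih ih2 ⊢
    simp only [mul_neg, Complex.I_mul_I, neg_neg, one_smul, neg_smul, neg_mul]
    linear_combination (norm := module) ih + ih2

/-- The recursion for `S` contains the indefinite term with `j = 2P - 1`. Its negative part `α⁻¹ Λ_k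
Λ_k* α⁻*` is rewritten by the operator identity and completes the square, leaving two positive
semidefinite summands. -/
theorem StronglyAdmissible.S_succ (hQ : Q.StronglyAdmissible) (k : ℕ) :
    Q.S (k + 1) = (1 - Complex.I • Q.α⁻¹) * Q.S k * (1 - Complex.I • Q.α⁻¹)ᴴ +
      (2 : ℂ) • (Q.α⁻¹ * (Q.Λ k * firstProj m₁ m₂) *
        (Q.α⁻¹ * (Q.Λ k * firstProj m₁ m₂))ᴴ) := by
  have ih := hQ.identity k
  have h1 := α_mul_inv hQ.isUnit_α
  have h2 := inv_mul_α hQ.isUnit_α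
  have hP : ∀ {p : ℕ} (X : Matrix (Fin m₁ ⊕ Fin m₂) (Fin p) ℂ),
        firstProj m₁ m₂ * (firstProj m₁ m₂ * X) = firstProj m₁ m₂ * X := fun X => by
      rw [← Matrix.mul_assoc, firstProj_mul_self]
  simp only [S, signature_eq]
  generalize Q.S k = S at ih ⊢
  generalize Q.Λ k = L at ih ⊢
  generalize Q.α⁻¹ = A at *
  have h4 : Q.αᴴ * Aᴴ = 1 := by rw [← Matrix.conjTranspose_mul, h2, Matrix.conjTranspose_one]
  have c2 : ∀ {p : ℕ} (X : Matrix (Fin n) (Fin p) ℂ), A * (Q.α * X) = X := fun X => by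
      rw [← Matrix.mul_assoc, h2, Matrix.one_mul]
  have ih2 := congrArg (fun M => A * M * Aᴴ) ih
  simp only [Matrix.mul_sub, Matrix.sub_mul, Matrix.mul_assoc,
      Matrix.conjTranspose_sub, Matrix.conjTranspose_smul, Matrix.conjTranspose_mul,
      Matrix.mul_smul, Matrix.smul_mul, c2, h4, Matrix.mul_one, Matrix.one_mul, hP,
      firstProj_conjTranspose, smul_sub, smul_smul, Complex.star_def, Complex.conj_I,
      Matrix.conjTranspose_one] at ih ih2 ⊢
  simp only [Complex.I_mul_I, neg_neg, one_smul, neg_smul, neg_mul]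
  linear_combination (norm := skip) (-Complex.I) • ih2
  simp only [smul_sub, smul_smul, neg_mul, Complex.I_mul_I]
  module

theorem Λ_succ_mul_firstProj (k : ℕ) :
    Q.Λ (k + 1) * firstProj m₁ m₂ = (1 + Complex.I • Q.α⁻¹) * (Q.Λ k * firstProj m₁ m₂) := by
  simp only [Λ, Matrix.add_mul, Matrix.smul_mul, Matrix.mul_assoc, signature_mul_firstProj,
    Matrix.one_mul]

/-- In `S_succ` the first summand degenerates only on vectors `x` for which `x*` is a left
eigenvector of `α` for the eigenvalue `i`. On those the second summand is a nonzero multiple of `|x*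
ϑ₁|²`, which is positive by controllability. -/
theorem StronglyAdmissible.posDef_S (hQ : Q.StronglyAdmissible) (k : ℕ) : (Q.S k).PosDef := by
  induction k with
  | zero => exact hQ.1.1
  | succ k ih =>
    have hh : (Q.S (k + 1)).IsHermitian := by
      rw [hQ.S_succ]
      refine Matrix.IsHermitian.add (Matrix.isHermitian_mul_mul_conjTranspose _ ih.isHermitian) ?_
      rw [Matrix.IsHermitian, Matrix.conjTranspose_smul,
        (Matrix.isHermitian_mul_conjTranspose_self _).eq]
      simp
    refine .of_dotProduct_mulVec_pos hh fun x hx => ?_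
    set B := (1 - Complex.I • Q.α⁻¹)ᴴ with hB
    set E := (Q.α⁻¹ * (Q.Λ k * firstProj m₁ m₂)) with hE
    have e : star x ⬝ᵥ Q.S (k + 1) *ᵥ x
        = star (B *ᵥ x) ⬝ᵥ Q.S k *ᵥ (B *ᵥ x) + 2 * (star (Eᴴ *ᵥ x) ⬝ᵥ (Eᴴ *ᵥ x)) := by
      rw [hQ.S_succ, Matrix.add_mulVec, dotProduct_add, Matrix.smul_mulVec, dotProduct_smul,
        ← Matrix.mulVec_mulVec, ← Matrix.mulVec_mulVec, ← Matrix.mulVec_mulVec,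
        Matrix.dotProduct_mulVec, Matrix.dotProduct_mulVec _ E, Matrix.star_mulVec,
        Matrix.star_mulVec, Matrix.conjTranspose_conjTranspose, hB,
        Matrix.conjTranspose_conjTranspose]
      rfl
    have hE0 : 0 ≤ star (Eᴴ *ᵥ x) ⬝ᵥ (Eᴴ *ᵥ x) := dotProduct_star_self_nonneg _
    rw [e]
    by_cases hBx : B *ᵥ x = 0
    · rw [hBx]
      simp only [Matrix.mulVec_zero, dotProduct_zero, zero_add]
      refine mul_pos two_pos (lt_of_le_of_ne hE0 fun h0 => hx ?_)
      have hEx : star x ᵥ* E = 0 := by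
        have : Eᴴ *ᵥ x = 0 := by simpa using h0.symm
        simpa [Matrix.star_mulVec] using congrArg star this
      have hBx' : star x ᵥ* (1 - Complex.I • Q.α⁻¹) = 0 := by
        simpa [Matrix.star_mulVec, hB, sub_eq_add_neg] using congrArg star hBx
      have hinv : star x ᵥ* Q.α⁻¹ = (-Complex.I) • star x := by
        rw [Matrix.vecMul_sub, Matrix.vecMul_one, Matrix.vecMul_smul, sub_eq_zero] at hBx'
        conv_rhs => rw [hBx', smul_smul]
        simp
      have hα : star x ᵥ* Q.α = Complex.I • star x := by
        have := congrArg (fun v => Complex.I • (v ᵥ* Q.α)) hinv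
        simp only [Matrix.vecMul_vecMul, inv_mul_α hQ.isUnit_α, Matrix.vecMul_one,
          Matrix.smul_vecMul, smul_smul] at this
        simpa using this.symm
      -- On `x*` the factor `1 + i α⁻¹` acts as the scalar `2`, so vanishing at step `k` descends to
      -- `ϑ₁`.
      have hpow : ∀ l, star x ᵥ* (Q.Λ l * firstProj m₁ m₂)
          = (2 : ℂ) ^ l • (star x ᵥ* (Q.Λ 0 * firstProj m₁ m₂)) := by
        intro l
        induction l with
        | zero => simp
        | succ l ihl =>
          rw [Λ_succ_mul_firstProj, ← Matrix.vecMul_vecMul, Matrix.vecMul_add, Matrix.vecMul_one,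
            Matrix.vecMul_smul, hinv, smul_smul]
          simp only [mul_neg, Complex.I_mul_I, neg_neg, one_smul]
          rw [Matrix.add_vecMul, ihl, ← two_smul ℂ, smul_smul, pow_succ']
      rw [hE, ← Matrix.vecMul_vecMul, hinv, Matrix.smul_vecMul, hpow, smul_smul,
        smul_eq_zero_iff_right (by simp)] at hEx
      have hϑ : star x ᵥ* Q.ϑ₁ = 0 := by
        rw [Λ, firstProj, Matrix.fromCols_mul_fromBlocks, Matrix.vecMul_fromCols] at hEx
        have := congrArg (fun v => v ∘ Sum.inl) hEx
        simpa using this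
      simpa using hQ.2.eq_zero_of_left_eigenvector hα hϑ
    · exact add_pos_of_pos_of_nonneg (ih.dotProduct_mulVec_pos hBx) (mul_nonneg zero_le_two hE0)

end Quadruple
end SkewDirac

/-! ### The Darboux transformation and the algebra of the potential. -/

namespace SkewDirac
namespace Quadruple

variable {n m₁ m₂ : ℕ} {Q : Quadruple n m₁ m₂}

theorem StronglyAdmissible.S_mul_inv (hQ : Q.StronglyAdmissible) (k : ℕ) :
    Q.S k * (Q.S k)⁻¹ = 1 :=
  Matrix.mul_nonsing_inv _ ((Matrix.isUnit_iff_isUnit_det _).1 (hQ.posDef_S k).isUnit)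

theorem StronglyAdmissible.inv_mul_S (hQ : Q.StronglyAdmissible) (k : ℕ) :
    (Q.S k)⁻¹ * Q.S k = 1 :=
  Matrix.nonsing_inv_mul _ ((Matrix.isUnit_iff_isUnit_det _).1 (hQ.posDef_S k).isUnit)

theorem StronglyAdmissible.inv_S_conjTranspose (hQ : Q.StronglyAdmissible) (k : ℕ) :
    ((Q.S k)⁻¹)ᴴ = (Q.S k)⁻¹ :=
  (hQ.posDef_S k).isHermitian.inv

/-- The operator identity for `S_k⁻¹`. -/
theorem StronglyAdmissible.identity_inv (hQ : Q.StronglyAdmissible) (k : ℕ) :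
    (Q.S k)⁻¹ * Q.α - Q.αᴴ * (Q.S k)⁻¹ =
      Complex.I • ((Q.S k)⁻¹ * (Q.Λ k * ((Q.Λ k)ᴴ * (Q.S k)⁻¹))) := by
  have h := congrArg (fun M => (Q.S k)⁻¹ * M * (Q.S k)⁻¹) (hQ.identity k)
  have h1 := hQ.S_mul_inv k
  have h2 : ∀ {p : ℕ} (X : Matrix (Fin n) (Fin p) ℂ), (Q.S k)⁻¹ * (Q.S k * X) = X := fun X => by
    rw [← Matrix.mul_assoc, hQ.inv_mul_S, Matrix.one_mul]
  simpa only [Matrix.mul_sub, Matrix.sub_mul, Matrix.mul_assoc, Matrix.mul_smul, Matrix.smul_mul,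
    h1, h2, Matrix.mul_one] using h

theorem StronglyAdmissible.S_succ_mul (hQ : Q.StronglyAdmissible) (k : ℕ) :
    Q.S (k + 1) * Q.αᴴ =
      (Q.α + Q.α⁻¹) * Q.S k - Complex.I • (Q.Λ (k + 1) * (Q.Λ k)ᴴ) := by
  have ih := hQ.identity k
  have h1 := α_mul_inv hQ.isUnit_α
  have h3 : (Q.α⁻¹)ᴴ * Q.αᴴ = 1 := by
    rw [← Matrix.conjTranspose_mul, h1, Matrix.conjTranspose_one]
  simp only [S, Λ, Matrix.add_mul, Matrix.mul_assoc, h3, Matrix.mul_one, Matrix.smul_mul, smul_add,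
    smul_smul, Complex.I_mul_I]
  linear_combination (norm := module) -ih

theorem Λ_succ_conjTranspose_mul (h : IsUnit Q.α) (k : ℕ) :
    (Q.Λ (k + 1))ᴴ * Q.αᴴ =
      (Q.Λ k)ᴴ * Q.αᴴ - Complex.I • (signature m₁ m₂ * (Q.Λ k)ᴴ) := by
  have h3 : (Q.α⁻¹)ᴴ * Q.αᴴ = 1 := by
    rw [← Matrix.conjTranspose_mul, α_mul_inv h, Matrix.conjTranspose_one]
  simp only [Λ, Matrix.conjTranspose_add, Matrix.conjTranspose_smul, Matrix.conjTranspose_mul,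
    Matrix.add_mul, Matrix.smul_mul, Matrix.mul_assoc, h3, Matrix.mul_one,
    signature_conjTranspose, Complex.star_def, Complex.conj_I]
  module

/-- This is the part of the Darboux relation that does not involve `z`. The product `Λ_{k+1} Λ_k*`
is eliminated by `S_succ_mul`, and `Λ_k Λ_k*` by the operator identity. -/
theorem StronglyAdmissible.potential_mul (hQ : Q.StronglyAdmissible) (k : ℕ) :
    Q.potential k * ((Q.Λ k)ᴴ * (Q.S k)⁻¹) =
      Complex.I • ((Q.Λ (k + 1))ᴴ * (Q.S (k + 1))⁻¹ * (Q.α + Q.α⁻¹)) -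
        Complex.I • ((Q.Λ k)ᴴ * (Q.S k)⁻¹ * Q.α) := by
  have ha := congrArg (fun M => (Q.Λ (k + 1))ᴴ * ((Q.S (k + 1))⁻¹ * (M * (Q.S k)⁻¹)))
    (hQ.S_succ_mul k)
  have hb := congrArg (fun M => M * (Q.S k)⁻¹) (Λ_succ_conjTranspose_mul hQ.isUnit_α k)
  have hc := congrArg (fun M => (Q.Λ k)ᴴ * M) (hQ.identity_inv k)
  have h1 := hQ.S_mul_inv k
  have h2 : ∀ {p : ℕ} (X : Matrix (Fin n) (Fin p) ℂ),
      (Q.S (k + 1))⁻¹ * (Q.S (k + 1) * X) = X := fun X => by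
    rw [← Matrix.mul_assoc, hQ.inv_mul_S, Matrix.one_mul]
  rw [potential]
  simp only [Matrix.mul_sub, Matrix.sub_mul, Matrix.mul_assoc, Matrix.mul_smul, Matrix.smul_mul,
    Matrix.add_mul, Matrix.mul_add, h1, h2, Matrix.mul_one, smul_add] at ha hb hc ⊢
  linear_combination (norm := skip) Complex.I • ha - Complex.I • hb + Complex.I • hc
  simp only [smul_sub, smul_smul, smul_add, Complex.I_mul_I]
  module

/-- The transfer function `W_k(z) = I - i Λ_k* S_k⁻¹ (z I + α)⁻¹ Λ_k`. -/
def transfer (Q : Quadruple n m₁ m₂) (k : ℕ) (z : ℂ) :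
    Matrix (Fin m₁ ⊕ Fin m₂) (Fin m₁ ⊕ Fin m₂) ℂ :=
  1 - Complex.I • ((Q.Λ k)ᴴ * ((Q.S k)⁻¹ *
    ((z • (1 : Matrix (Fin n) (Fin n) ℂ) + Q.α)⁻¹ * Q.Λ k)))

/-- The Darboux transformation intertwines the system with the trivial one. -/
theorem StronglyAdmissible.darboux (hQ : Q.StronglyAdmissible) (k : ℕ) {z : ℂ}
    (hz : IsUnit (z • (1 : Matrix (Fin n) (Fin n) ℂ) + Q.α)) :
    (z • 1 + Complex.I • Q.potential k) * Q.transfer k z =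
      Q.transfer (k + 1) z * (z • 1 + Complex.I • signature m₁ m₂) := by
  have hK := hQ.potential_mul k
  have h1 := α_mul_inv hQ.isUnit_α
  have h2 := inv_mul_α hQ.isUnit_α
  have r1 := Matrix.mul_nonsing_inv _ ((Matrix.isUnit_iff_isUnit_det _).1 hz)
  have r2 := Matrix.nonsing_inv_mul _ ((Matrix.isUnit_iff_isUnit_det _).1 hz)
  rw [transfer, transfer]
  generalize (z • (1 : Matrix (Fin n) (Fin n) ℂ) + Q.α)⁻¹ = R at *
  have e1 : z • R = 1 - Q.α * R := by rw [← r1, Matrix.add_mul]; simp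
  have e1' : z • R = 1 - R * Q.α := by rw [← r2, Matrix.mul_add]; simp
  have e2 : z • (R * Q.α⁻¹) = Q.α⁻¹ - R := by
    rw [← Matrix.smul_mul, e1', Matrix.sub_mul, Matrix.mul_assoc, h1]; simp
  have e2' : z • (Q.α⁻¹ * R) = Q.α⁻¹ - R := by
    rw [← Matrix.mul_smul, e1, Matrix.mul_sub, ← Matrix.mul_assoc, h2]; simp
  -- For `z ≠ 0` the factor `z` cancels. The case `z = 0` needs its own argument, and it is the one
  -- that later shows `C_k² = 1`.
  have e3 : R * Q.α⁻¹ = Q.α⁻¹ * R := by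
    rcases eq_or_ne z 0 with rfl | h0
    · have : Q.α * R = 1 := by simpa using r1
      have : R = Q.α⁻¹ := by
        calc R = Q.α⁻¹ * Q.α * R := by rw [h2, Matrix.one_mul]
          _ = Q.α⁻¹ := by rw [Matrix.mul_assoc, this, Matrix.mul_one]
      rw [this]
    · exact smul_right_injective _ h0 (e2.trans e2'.symm)
  have hΛ : Q.Λ (k + 1) = Q.Λ k + Complex.I • (Q.α⁻¹ * Q.Λ k * signature m₁ m₂) := rfl
  have hC : Q.potential k = signature m₁ m₂ + (Q.Λ k)ᴴ * (Q.S k)⁻¹ * Q.Λ k -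
    (Q.Λ (k + 1))ᴴ * (Q.S (k + 1))⁻¹ *
      (Q.Λ k + Complex.I • (Q.α⁻¹ * Q.Λ k * signature m₁ m₂)) := rfl
  -- Only the unconjugated `Λ_{k+1}` is expanded. Its adjoint and `S_{k+1}⁻¹` stay atoms, so the
  -- rest is linear in the relations below.
  generalize Q.potential k = C at *
  generalize (Q.Λ (k + 1))ᴴ = L' at *
  rw [hΛ]
  generalize (Q.Λ k)ᴴ = L at *
  generalize Q.Λ k = M at *
  have f1 := congrArg (fun N => N * (R * M)) hK
  have f2 := congrArg (fun N => L * ((Q.S k)⁻¹ * (N * M))) e1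
  have f3 := congrArg (fun N => L' * ((Q.S (k + 1))⁻¹ * (N * M))) e1
  have f4 := congrArg (fun N => L' * ((Q.S (k + 1))⁻¹ * (N * (M * signature m₁ m₂)))) e2
  have f5 := congrArg (fun N => L' * ((Q.S (k + 1))⁻¹ * (N * M))) e3
  have hj : M * (signature m₁ m₂ * signature m₁ m₂) = M := by
    rw [signature_mul_self, Matrix.mul_one]
  simp only [Matrix.mul_sub, Matrix.sub_mul, Matrix.mul_assoc, Matrix.mul_smul, Matrix.smul_mul,
    Matrix.add_mul, Matrix.mul_add, Matrix.mul_one, Matrix.one_mul, smul_add, smul_sub, smul_smul,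
    Complex.I_mul_I, hj] at f1 f2 f3 f4 f5 hC ⊢
  linear_combination (norm := skip) f1 - Complex.I • f2 + Complex.I • hC + Complex.I • f3 - f4
    - Complex.I • f5
  simp only [smul_sub, smul_smul, smul_add, Complex.I_mul_I]
  module

/-- `tr (Λ_k* S_k⁻¹ Λ_k)` does not depend on `k`. -/
theorem StronglyAdmissible.trace_eq (hQ : Q.StronglyAdmissible) (k : ℕ) :
    ((Q.Λ k)ᴴ * ((Q.S k)⁻¹ * Q.Λ k)).trace = 2 * Q.α.trace.im := by
  have h := congrArg (fun M => ((Q.S k)⁻¹ * M).trace) (hQ.identity k)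
  have e : ((Q.S k)⁻¹ * (Q.S k * Q.αᴴ)).trace = star Q.α.trace := by
    rw [← Matrix.mul_assoc, hQ.inv_mul_S, Matrix.one_mul, Matrix.trace_conjTranspose]
  have e' : ((Q.S k)⁻¹ * (Q.α * Q.S k)).trace = Q.α.trace := by
    rw [Matrix.trace_mul_comm, Matrix.mul_assoc, hQ.S_mul_inv, Matrix.mul_one]
  have e'' : ((Q.S k)⁻¹ * (Q.Λ k * (Q.Λ k)ᴴ)).trace
      = ((Q.Λ k)ᴴ * ((Q.S k)⁻¹ * Q.Λ k)).trace := by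
    rw [← Matrix.mul_assoc, Matrix.trace_mul_comm]
  simp only [Matrix.mul_sub, Matrix.trace_sub, e, e', Matrix.mul_smul, Matrix.trace_smul, e'',
    smul_eq_mul] at h
  have h' : Q.α.trace - star Q.α.trace = 2 * Q.α.trace.im * Complex.I := by
    rw [Complex.star_def, Complex.sub_conj]; push_cast; ring
  rw [h'] at h
  apply mul_left_cancel₀ Complex.I_ne_zero
  rw [← h]; ring

theorem StronglyAdmissible.trace_potential (hQ : Q.StronglyAdmissible) (k : ℕ) :
    (Q.potential k).trace = (signature m₁ m₂).trace := by
  rw [potential, Matrix.trace_sub, Matrix.trace_add, Matrix.mul_assoc, Matrix.mul_assoc,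
    hQ.trace_eq, hQ.trace_eq, add_sub_cancel_right]

theorem StronglyAdmissible.isHermitian_potential (hQ : Q.StronglyAdmissible) (k : ℕ) :
    (Q.potential k).IsHermitian := by
  simp only [Matrix.IsHermitian, potential, Matrix.conjTranspose_sub, Matrix.conjTranspose_add,
    Matrix.conjTranspose_mul, signature_conjTranspose, hQ.inv_S_conjTranspose,
    Matrix.conjTranspose_conjTranspose, Matrix.mul_assoc]

/-- The operator identity for `S_k⁻¹`, placed between `α⁻*` and `α⁻¹`, makes the quadratic term
cancel the linear ones. -/
theorem StronglyAdmissible.transfer_zero_unitary (hQ : Q.StronglyAdmissible) (k : ℕ) :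
    (Q.transfer k 0)ᴴ * Q.transfer k 0 = 1 := by
  have h := congrArg (fun M => (Q.Λ k)ᴴ * ((Q.α⁻¹)ᴴ * (M * (Q.α⁻¹ * Q.Λ k)))) (hQ.identity_inv k)
  have c1 : ∀ {ι : Type} (X : Matrix (Fin n) ι ℂ), Q.α * (Q.α⁻¹ * X) = X := fun X => by
    rw [← Matrix.mul_assoc, α_mul_inv hQ.isUnit_α, Matrix.one_mul]
  have c2 : ∀ {ι : Type} (X : Matrix (Fin n) ι ℂ), (Q.α⁻¹)ᴴ * (Q.αᴴ * X) = X := fun X => by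
    rw [← Matrix.mul_assoc, ← Matrix.conjTranspose_mul, α_mul_inv hQ.isUnit_α,
      Matrix.conjTranspose_one, Matrix.one_mul]
  simp only [transfer, zero_smul, zero_add, Matrix.conjTranspose_sub, Matrix.conjTranspose_smul,
    Matrix.conjTranspose_mul, Matrix.conjTranspose_one, hQ.inv_S_conjTranspose,
    Matrix.conjTranspose_conjTranspose, Matrix.mul_sub, Matrix.sub_mul, Matrix.mul_assoc,
    Matrix.mul_smul, Matrix.smul_mul, smul_sub, smul_smul, Complex.star_def, Complex.conj_I,
    Matrix.mul_one, Matrix.one_mul, c1, c2, Complex.I_mul_I, mul_neg] at h ⊢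
  linear_combination (norm := skip) Complex.I • h
  simp only [smul_sub, smul_smul, Complex.I_mul_I]
  module

theorem StronglyAdmissible.potential_mul_self (hQ : Q.StronglyAdmissible) (k : ℕ) :
    Q.potential k * Q.potential k = 1 := by
  have hd := hQ.darboux k (z := 0) (by simpa using hQ.isUnit_α)
  simp only [zero_smul, zero_add, Matrix.smul_mul, Matrix.mul_smul] at hd
  have hd' := smul_right_injective _ Complex.I_ne_zero hd
  have hu := hQ.transfer_zero_unitary k
  have hu' := hQ.transfer_zero_unitary (k + 1)
  have hW := mul_eq_one_comm.1 hu
  have hC : Q.potential k = Q.transfer (k + 1) 0 * signature m₁ m₂ * (Q.transfer k 0)ᴴ := by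
    rw [← hd', Matrix.mul_assoc, hW, Matrix.mul_one]
  -- Self-adjointness reverses the order of the unitaries, so the factors `W_{k+1}(0)` cancel when
  -- this form is multiplied by the previous one.
  have hC' : Q.potential k = Q.transfer k 0 * (signature m₁ m₂ * (Q.transfer (k + 1) 0)ᴴ) := by
    rw [← (hQ.isHermitian_potential k).eq, hC]
    simp [signature_conjTranspose]
  calc _ = Q.transfer k 0 * (signature m₁ m₂ * (Q.transfer (k + 1) 0)ᴴ) *
        (Q.transfer (k + 1) 0 * signature m₁ m₂ * (Q.transfer k 0)ᴴ) := by rw [← hC', ← hC]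
    _ = Q.transfer k 0 * (signature m₁ m₂ *
          (((Q.transfer (k + 1) 0)ᴴ * Q.transfer (k + 1) 0) * signature m₁ m₂)) *
          (Q.transfer k 0)ᴴ := by simp only [Matrix.mul_assoc]
    _ = 1 := by rw [hu', Matrix.one_mul, signature_mul_self, Matrix.mul_one, hW]

end Quadruple
end SkewDirac

/-! ### Unitary equivalence of the potential with `j`. -/

namespace SkewDirac

/-- Two `±1`-valued functions with equal sums differ by a permutation. -/
theorem exists_perm_comp_eq {ι : Type*} [Fintype ι] {a b : ι → ℝ}
    (ha : ∀ i, a i = 1 ∨ a i = -1) (hb : ∀ i, b i = 1 ∨ b i = -1)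
    (h : ∑ i, a i = ∑ i, b i) : ∃ σ : Equiv.Perm ι, ∀ i, a (σ i) = b i := by
  classical
  have key : ∀ c : ι → ℝ, (∀ i, c i = 1 ∨ c i = -1) →
      ∑ i, c i = 2 * (Fintype.card {i // c i = 1} : ℝ) - Fintype.card ι := by
    intro c hc
    have : ∀ i, c i = 2 * (if c i = 1 then 1 else 0) - 1 := by
      intro i
      rcases hc i with h | h <;> rw [h] <;> norm_num
    rw [Finset.sum_congr rfl fun i _ => this i, Finset.sum_sub_distrib, ← Finset.mul_sum,
      Finset.sum_boole, Fintype.card_subtype]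
    simp
  have hcard : Fintype.card {i // b i = 1} = Fintype.card {i // a i = 1} := by
    have := key a ha
    have := key b hb
    have : (Fintype.card {i // b i = 1} : ℝ) = Fintype.card {i // a i = 1} := by linarith
    exact_mod_cast this
  let e := Fintype.equivOfCardEq hcard
  refine ⟨e.extendSubtype, fun i => ?_⟩
  by_cases hi : b i = 1
  · rw [hi]; exact e.extendSubtype_mem i hi
  · have := e.extendSubtype_not_mem i hi
    rw [(hb i).resolve_left hi]
    exact (ha _).resolve_left this

/-- A Hermitian involution with the trace of `j` is unitarily equivalent to `j`. -/
theorem exists_unitary_conj_signature {m₁ m₂ : ℕ}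
    {C : Matrix (Fin m₁ ⊕ Fin m₂) (Fin m₁ ⊕ Fin m₂) ℂ} (hC : C.IsHermitian) (hCC : C * C = 1)
    (htr : C.trace = (signature m₁ m₂).trace) :
    ∃ U ∈ Matrix.unitaryGroup (Fin m₁ ⊕ Fin m₂) ℂ, C = Uᴴ * signature m₁ m₂ * U := by
  set V : Matrix (Fin m₁ ⊕ Fin m₂) (Fin m₁ ⊕ Fin m₂) ℂ :=
    hC.eigenvectorUnitary.1 with hV
  have hVV : Vᴴ * V = 1 := Unitary.coe_star_mul_self hC.eigenvectorUnitary
  have hVV' : V * Vᴴ = 1 := Unitary.coe_mul_star_self hC.eigenvectorUnitary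
  have hspec : C = V * Matrix.diagonal (fun i => (hC.eigenvalues i : ℂ)) * Vᴴ := by
    conv_lhs => rw [hC.spectral_theorem, Unitary.conjStarAlgAut_apply]
    rfl
  have hdiag : Matrix.diagonal (fun i => (hC.eigenvalues i : ℂ)) = Vᴴ * C * V := by
    conv_rhs => rw [hspec]
    simp only [Matrix.mul_assoc, hVV, Matrix.mul_one]
    rw [← Matrix.mul_assoc, hVV, Matrix.one_mul]
  have hsq : Matrix.diagonal (fun i => (hC.eigenvalues i : ℂ)) *
      Matrix.diagonal (fun i => (hC.eigenvalues i : ℂ)) = 1 := by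
    rw [hdiag]
    calc _ = Vᴴ * (C * (V * Vᴴ) * C) * V := by simp only [Matrix.mul_assoc]
      _ = 1 := by rw [hVV', Matrix.mul_one, hCC, Matrix.mul_one, hVV]
  let d : Fin m₁ ⊕ Fin m₂ → ℝ := Sum.elim (fun _ => 1) (fun _ => -1)
  have hd : signature m₁ m₂ = Matrix.diagonal (fun i => (d i : ℂ)) := by
    ext (i | i) (k | k) <;> simp [signature, d, Matrix.diagonal_apply, Matrix.one_apply]
    split_ifs <;> simp
  have hev : ∀ i, hC.eigenvalues i = 1 ∨ hC.eigenvalues i = -1 := by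
    intro i
    have := congrFun (congrFun hsq i) i
    rw [Matrix.diagonal_mul_diagonal, Matrix.diagonal_apply_eq, Matrix.one_apply_eq] at this
    exact mul_self_eq_one_iff.1 (by exact_mod_cast this)
  -- All eigenvalues are `±1`, so the trace fixes their multiplicities. A permutation of the
  -- eigenvectors then produces `j` itself.
  have hsum : ∑ i, hC.eigenvalues i = ∑ i, d i := by
    rw [hC.trace_eq_sum_eigenvalues, hd, Matrix.trace_diagonal] at htr
    simpa using congrArg Complex.re htr
  obtain ⟨σ, hσ⟩ := exists_perm_comp_eq hev (b := d) (by rintro (i | i) <;> simp [d]) hsum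
  refine ⟨(V.submatrix id σ)ᴴ, ?_, ?_⟩
  · rw [Matrix.mem_unitaryGroup_iff, Matrix.star_eq_conjTranspose,
      Matrix.conjTranspose_conjTranspose, Matrix.conjTranspose_submatrix,
      ← Matrix.submatrix_mul _ _ σ id σ Function.bijective_id, hVV, Matrix.submatrix_one_equiv]
  · have : Matrix.diagonal (fun i => (d i : ℂ)) =
        (Matrix.diagonal (fun i => (hC.eigenvalues i : ℂ))).submatrix σ σ := by
      rw [Matrix.submatrix_diagonal_equiv]
      congr 1; funext i; simp [hσ]
    rw [Matrix.conjTranspose_conjTranspose, hd, this, Matrix.conjTranspose_submatrix,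
      Matrix.submatrix_mul_equiv, Matrix.submatrix_mul_equiv, Matrix.submatrix_id_id]
    exact hspec

theorem Quadruple.StronglyAdmissible.isDiracPotential {n m₁ m₂ : ℕ} {Q : Quadruple n m₁ m₂}
    (hQ : Q.StronglyAdmissible) : IsDiracPotential Q.potential := fun k =>
  exists_unitary_conj_signature (hQ.isHermitian_potential k) (hQ.potential_mul_self k)
    (hQ.trace_potential k)

open scoped MatrixOrder Matrix.Norms.L2Operator in
theorem exists_eq_conjTranspose_mul_self {n : ℕ} {M : Matrix (Fin n) (Fin n) ℂ}
    (h : M.PosSemidef) : ∃ B : Matrix (Fin n) (Fin n) ℂ, M = Bᴴ * B :=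
  CStarAlgebra.nonneg_iff_eq_star_mul_self.mp h.nonneg

end SkewDirac

/-! ### Frobenius norm estimates for the transfer functions, uniform in `k`. -/

namespace SkewDirac

open scoped Matrix.Norms.Frobenius

theorem frobenius_norm_sq {ι κ : Type*} [Fintype ι] [Fintype κ] (A : Matrix ι κ ℂ) :
    ‖A‖ ^ 2 = ∑ i, ∑ j, ‖A i j‖ ^ 2 := by
  have h0 : 0 ≤ ∑ i, ∑ j, ‖A i j‖ ^ 2 :=
    Finset.sum_nonneg fun i _ => Finset.sum_nonneg fun j _ => by positivity
  rw [Matrix.frobenius_norm_def, ← Real.rpow_natCast, ← Real.rpow_mul (by simpa using h0)]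
  norm_num

theorem norm_apply_le_frobenius {ι κ : Type*} [Fintype ι] [Fintype κ] (A : Matrix ι κ ℂ) (i : ι)
    (j : κ) : ‖A i j‖ ≤ ‖A‖ := by
  rw [← pow_le_pow_iff_left₀ (norm_nonneg _) (norm_nonneg _) two_ne_zero, frobenius_norm_sq]
  refine (Finset.single_le_sum (f := fun j => ‖A i j‖ ^ 2) (fun j _ => by positivity)
    (Finset.mem_univ j)).trans ?_
  exact Finset.single_le_sum (f := fun i => ∑ j, ‖A i j‖ ^ 2)
    (fun i _ => Finset.sum_nonneg fun j _ => by positivity) (Finset.mem_univ i)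

theorem trace_conjTranspose_mul_self {ι κ : Type*} [Fintype ι] [Fintype κ] (A : Matrix ι κ ℂ) :
    (Aᴴ * A).trace = ((‖A‖ ^ 2 : ℝ) : ℂ) := by
  rw [frobenius_norm_sq]
  simp only [Matrix.trace, Matrix.diag_apply, Matrix.mul_apply, Matrix.conjTranspose_apply]
  rw [Finset.sum_comm]
  push_cast
  refine Finset.sum_congr rfl fun i _ => Finset.sum_congr rfl fun j _ => ?_
  rw [Complex.star_def, Complex.conj_mul']

/-- Expand `‖c A + i B‖² ≥ 0` and divide by `c`. -/
theorem two_mul_im_trace_le {ι κ : Type*} [Fintype ι] [Fintype κ] (A B : Matrix ι κ ℂ) {c : ℝ}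
    (hc : 0 < c) : 2 * (Aᴴ * B).trace.im ≤ c * ‖A‖ ^ 2 + ‖B‖ ^ 2 / c := by
  have h := trace_conjTranspose_mul_self ((c : ℂ) • A + Complex.I • B)
  have hBA : (Bᴴ * A).trace = star (Aᴴ * B).trace := by
    rw [← Matrix.trace_conjTranspose, Matrix.conjTranspose_mul, Matrix.conjTranspose_conjTranspose]
  simp only [Matrix.conjTranspose_add, Matrix.conjTranspose_smul, Matrix.add_mul, Matrix.mul_add,
    Matrix.smul_mul, Matrix.mul_smul, Matrix.trace_add, Matrix.trace_smul,
    trace_conjTranspose_mul_self, hBA] at h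
  have h' := congrArg Complex.re h
  simp [-Complex.ofReal_pow] at h'
  have h0 := (sq_nonneg _).trans_eq h'.symm
  have : c * (2 * (Aᴴ * B).trace.im) ≤ c * (c * ‖A‖ ^ 2 + ‖B‖ ^ 2 / c) := by
    have e : c * (c * ‖A‖ ^ 2 + ‖B‖ ^ 2 / c) = c * (c * ‖A‖ ^ 2) + ‖B‖ ^ 2 := by
      field_simp
    rw [e]; linarith
  exact le_of_mul_le_mul_left this hc

namespace Quadruple

variable {n m₁ m₂ p : ℕ} {Q : Quadruple n m₁ m₂}

/-- The weight `S_k⁻¹` is absorbed into a norm. The size of `B Λ_k` does not depend on `k`, which is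
the source of all uniform bounds. -/
theorem StronglyAdmissible.exists_factorization (hQ : Q.StronglyAdmissible) (k : ℕ) :
    ∃ B : Matrix (Fin n) (Fin n) ℂ,
      (Q.S k)⁻¹ = Bᴴ * B ∧ ‖B * Q.Λ k‖ ^ 2 = 2 * Q.α.trace.im := by
  obtain ⟨B, hB⟩ := exists_eq_conjTranspose_mul_self (hQ.posDef_S k).inv.posSemidef
  refine ⟨B, hB, ?_⟩
  have := trace_conjTranspose_mul_self (B * Q.Λ k)
  rw [Matrix.conjTranspose_mul, Matrix.mul_assoc, ← Matrix.mul_assoc Bᴴ, ← hB, hQ.trace_eq] at this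
  exact_mod_cast this.symm

/-- The energy balance of the transfer function. -/
theorem StronglyAdmissible.exists_energy_balance (hQ : Q.StronglyAdmissible) (k : ℕ) {z : ℂ}
    (hz : 0 < z.im) (V : Matrix (Fin m₁ ⊕ Fin m₂) (Fin p) ℂ) :
    ∃ (g : Matrix (Fin m₁ ⊕ Fin m₂) (Fin p) ℂ) (F : Matrix (Fin n) (Fin p) ℂ),
      Q.transfer k z * V = V - Complex.I • g ∧
      2 * (gᴴ * V).trace.im = ‖g‖ ^ 2 + 2 * z.im * ‖F‖ ^ 2 ∧
      ‖g‖ ^ 2 ≤ 2 * Q.α.trace.im * ‖F‖ ^ 2 ∧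
      2 * (gᴴ * V).trace.im ≤ z.im * ‖F‖ ^ 2 + 2 * Q.α.trace.im * ‖V‖ ^ 2 / z.im := by
  obtain ⟨B, hB, hBΛ⟩ := hQ.exists_factorization k
  set R := (z • (1 : Matrix (Fin n) (Fin n) ℂ) + Q.α)⁻¹ with hR
  have r1 := Matrix.mul_nonsing_inv _
    ((Matrix.isUnit_iff_isUnit_det _).1 (hQ.isUnit_add hz.le))
  rw [← hR] at r1
  set f := R * (Q.Λ k * V) with hf
  set g := (Q.Λ k)ᴴ * ((Q.S k)⁻¹ * f) with hg
  have hΛV : Q.Λ k * V = z • f + Q.α * f := by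
    calc Q.Λ k * V = (z • 1 + Q.α) * R * (Q.Λ k * V) := by rw [r1, Matrix.one_mul]
      _ = _ := by rw [Matrix.mul_assoc, ← hf, Matrix.add_mul, Matrix.smul_mul, Matrix.one_mul]
  have hgH : gᴴ = fᴴ * ((Q.S k)⁻¹ * Q.Λ k) := by
    rw [hg, Matrix.conjTranspose_mul, Matrix.conjTranspose_mul, Matrix.conjTranspose_conjTranspose,
      hQ.inv_S_conjTranspose, Matrix.mul_assoc]
  have hq : (fᴴ * ((Q.S k)⁻¹ * f)).trace = ((‖B * f‖ ^ 2 : ℝ) : ℂ) := by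
    rw [← trace_conjTranspose_mul_self, hB, Matrix.conjTranspose_mul B f]
    simp only [Matrix.mul_assoc]
  refine ⟨g, B * f, ?_, ?_, ?_, ?_⟩
  · simp only [transfer, Matrix.sub_mul, Matrix.one_mul, Matrix.smul_mul, hg, hf, hR,
      Matrix.mul_assoc]
  · have hid := congrArg (fun M => (fᴴ * (M * f)).trace) (hQ.identity_inv k)
    have e1 : (fᴴ * ((Complex.I • ((Q.S k)⁻¹ * (Q.Λ k * ((Q.Λ k)ᴴ * (Q.S k)⁻¹)))) * f)).trace
        = Complex.I * ((‖g‖ ^ 2 : ℝ) : ℂ) := by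
      rw [← trace_conjTranspose_mul_self g, hgH, hg]
      simp only [Matrix.smul_mul, Matrix.mul_smul, Matrix.trace_smul, smul_eq_mul,
        Matrix.mul_assoc]
    have e2 : (fᴴ * (Q.αᴴ * ((Q.S k)⁻¹ * f))).trace
        = star (fᴴ * ((Q.S k)⁻¹ * (Q.α * f))).trace := by
      rw [← Matrix.trace_conjTranspose]
      simp only [Matrix.conjTranspose_mul, Matrix.conjTranspose_conjTranspose,
        hQ.inv_S_conjTranspose, Matrix.mul_assoc]
    beta_reduce at hid
    rw [e1] at hid
    simp only [Matrix.sub_mul, Matrix.mul_sub, Matrix.mul_assoc, Matrix.trace_sub, e2] at hid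
    have hid' := congrArg Complex.im hid
    rw [hgH, Matrix.mul_assoc, Matrix.mul_assoc, hΛV]
    simp only [Matrix.mul_add, Matrix.mul_smul, Matrix.trace_add, Matrix.trace_smul, hq,
      smul_eq_mul]
    simp [-Complex.ofReal_pow] at hid' ⊢
    linarith
  · have e : g = (B * Q.Λ k)ᴴ * (B * f) := by
      rw [hg, hB, Matrix.conjTranspose_mul]; simp only [Matrix.mul_assoc]
    rw [e, ← hBΛ, ← mul_pow, ← Matrix.frobenius_norm_conjTranspose (B * Q.Λ k)]
    gcongr
    exact Matrix.frobenius_norm_mul _ _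
  · have e : gᴴ * V = (B * f)ᴴ * (B * Q.Λ k * V) := by
      rw [hgH, hB, Matrix.conjTranspose_mul B f]; simp only [Matrix.mul_assoc]
    rw [e]
    refine (two_mul_im_trace_le _ _ hz).trans ?_
    rw [← hBΛ, ← mul_pow]
    gcongr
    exact Matrix.frobenius_norm_mul _ _

theorem norm_sub_I_smul_sq (V g : Matrix (Fin m₁ ⊕ Fin m₂) (Fin p) ℂ) :
    ‖V - Complex.I • g‖ ^ 2 = ‖V‖ ^ 2 + ‖g‖ ^ 2 - 2 * (gᴴ * V).trace.im := by
  have h := trace_conjTranspose_mul_self (V - Complex.I • g)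
  have hBA : (Vᴴ * g).trace = star (gᴴ * V).trace := by
    rw [← Matrix.trace_conjTranspose, Matrix.conjTranspose_mul, Matrix.conjTranspose_conjTranspose]
  simp only [Matrix.conjTranspose_sub, Matrix.conjTranspose_smul, Matrix.sub_mul, Matrix.mul_sub,
    Matrix.smul_mul, Matrix.mul_smul, Matrix.trace_sub, Matrix.trace_smul,
    trace_conjTranspose_mul_self, hBA] at h
  have h' := congrArg Complex.re h
  simp [-Complex.ofReal_pow] at h'
  linarith

/-- The transfer function is contractive in the upper half-plane. -/
theorem StronglyAdmissible.norm_transfer_mul_le (hQ : Q.StronglyAdmissible) (k : ℕ) {z : ℂ}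
    (hz : 0 < z.im) (V : Matrix (Fin m₁ ⊕ Fin m₂) (Fin p) ℂ) :
    ‖Q.transfer k z * V‖ ≤ ‖V‖ := by
  obtain ⟨g, F, h1, h2, -, -⟩ := hQ.exists_energy_balance k hz V
  rw [← pow_le_pow_iff_left₀ (norm_nonneg _) (norm_nonneg _) two_ne_zero, h1, norm_sub_I_smul_sq,
    h2]
  have : 0 ≤ 2 * z.im * ‖F‖ ^ 2 := by positivity
  linarith

/-- The transfer functions are uniformly invertible far up in the upper half-plane. -/
theorem StronglyAdmissible.norm_le_two_mul_norm_transfer_mul (hQ : Q.StronglyAdmissible) (k : ℕ)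
    {z : ℂ} (hz : 0 < z.im) (hzα : 4 * Q.α.trace.im ≤ z.im)
    (V : Matrix (Fin m₁ ⊕ Fin m₂) (Fin p) ℂ) :
    ‖V‖ ≤ 2 * ‖Q.transfer k z * V‖ := by
  obtain ⟨g, F, h1, h2, h3, h4⟩ := hQ.exists_energy_balance k hz V
  rw [h1]
  have hT : 0 ≤ 2 * Q.α.trace.im := by
    obtain ⟨B, -, hB⟩ := hQ.exists_factorization k
    rw [← hB]; positivity
  set T := 2 * Q.α.trace.im
  -- Comparing the balance `h2` with the upper bound `h4` absorbs one of the two copies of `Im z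
  -- ‖F‖²`. Then `Im z ≥ 2 T` makes `g` at most half of `V`.
  have hF : z.im ^ 2 * ‖F‖ ^ 2 ≤ T * ‖V‖ ^ 2 := by
    have : z.im * ‖F‖ ^ 2 ≤ T * ‖V‖ ^ 2 / z.im := by nlinarith [sq_nonneg ‖g‖]
    rw [le_div_iff₀ hz] at this
    linarith
  have hg : ‖g‖ ≤ ‖V‖ / 2 := by
    rw [← pow_le_pow_iff_left₀ (norm_nonneg _) (by positivity) two_ne_zero]
    have a1 : z.im ^ 2 * ‖g‖ ^ 2 ≤ T * (T * ‖V‖ ^ 2) := by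
      calc z.im ^ 2 * ‖g‖ ^ 2 ≤ z.im ^ 2 * (T * ‖F‖ ^ 2) := by gcongr
        _ = T * (z.im ^ 2 * ‖F‖ ^ 2) := by ring
        _ ≤ _ := by gcongr
    have a2 : T * (T * ‖V‖ ^ 2) ≤ z.im ^ 2 * (‖V‖ / 2) ^ 2 := by
      have : T ^ 2 ≤ (z.im / 2) ^ 2 := by
        gcongr; simp only [T]; linarith
      nlinarith [sq_nonneg ‖V‖]
    exact le_of_mul_le_mul_left (a1.trans a2) (by positivity)
  have : ‖V‖ ≤ ‖V - Complex.I • g‖ + ‖Complex.I • g‖ := by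
    simpa using norm_add_le (V - Complex.I • g) (Complex.I • g)
  rw [norm_smul, Complex.norm_I, one_mul] at this
  linarith

end Quadruple
end SkewDirac

/-! ### Explicit solutions and the summability condition at a fixed point. -/

namespace SkewDirac

open scoped Matrix.Norms.Frobenius
open Filter Topology

variable {n m₁ m₂ : ℕ}

theorem signature_step_pow (c : ℂ) (k : ℕ) {p : ℕ} (G₁ : Matrix (Fin m₁) (Fin p) ℂ)
    (G₂ : Matrix (Fin m₂) (Fin p) ℂ) :
    (1 + c • signature m₁ m₂) ^ k * Matrix.fromRows G₁ G₂ =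
      Matrix.fromRows ((1 + c) ^ k • G₁) ((1 - c) ^ k • G₂) := by
  have h : 1 + c • signature m₁ m₂ = Matrix.fromBlocks ((1 + c) • 1) 0 0 ((1 - c) • 1) := by
    rw [signature, Matrix.fromBlocks_smul, ← Matrix.fromBlocks_one, Matrix.fromBlocks_add]
    congr 1 <;> simp [add_smul, sub_eq_add_neg]
  induction k with
  | zero => simp
  | succ k ih =>
    rw [pow_succ', Matrix.mul_assoc, ih, h, Matrix.fromBlocks_mul_fromRows]
    simp [smul_smul, pow_succ]

/-- The initial value `[V; I]` of the solution in the Weyl series. -/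
def weylColumn (V : Matrix (Fin m₁) (Fin m₂) ℂ) : Matrix (Fin m₁ ⊕ Fin m₂) (Fin m₂) ℂ :=
  Matrix.fromRows V 1

/-- The terms of the Weyl series are Gram matrices. -/
theorem weylSummable_iff {C : ℕ → Matrix (Fin m₁ ⊕ Fin m₂) (Fin m₁ ⊕ Fin m₂) ℂ} {z : ℂ}
    {V : Matrix (Fin m₁) (Fin m₂) ℂ} :
    WeylSummable C z V ↔ Summable fun k : ℕ =>
      (fundSol C z k * weylColumn V)ᴴ *
        (fundSol C z k * weylColumn V) := by
  rw [WeylSummable]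
  simp only [weylColumn, Matrix.conjTranspose_mul, Matrix.conjTranspose_fromRows_eq_fromCols_conjTranspose,
    Matrix.conjTranspose_one, Matrix.mul_assoc]

theorem WeylSummable.tendsto_zero {C : ℕ → Matrix (Fin m₁ ⊕ Fin m₂) (Fin m₁ ⊕ Fin m₂) ℂ} {z : ℂ}
    {V : Matrix (Fin m₁) (Fin m₂) ℂ} (h : WeylSummable C z V) :
    Tendsto (fun k => ‖fundSol C z k * weylColumn V‖)
      atTop (𝓝 0) := by
  have h0 := (weylSummable_iff.1 h).tendsto_atTop_zero
  have hcont : Continuous fun M : Matrix (Fin m₂) (Fin m₂) ℂ => M.trace.re :=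
    Complex.continuous_re.comp continuous_id.matrix_trace
  have h1 := (hcont.tendsto 0).comp h0
  simp only [Function.comp_def, trace_conjTranspose_mul_self, Complex.ofReal_re, Matrix.trace_zero,
    Complex.zero_re] at h1
  simpa using h1.sqrt

namespace Quadruple

variable {Q : Quadruple n m₁ m₂}

/-- The fundamental solution in terms of the transfer functions. -/
theorem StronglyAdmissible.fundSol_mul_transfer (hQ : Q.StronglyAdmissible) {z : ℂ}
    (hz : 0 < z.im) (k : ℕ) :
    fundSol Q.potential z k * Q.transfer 0 z =
      Q.transfer k z * (1 + (Complex.I * z⁻¹) • signature m₁ m₂) ^ k := by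
  have hz0 : z ≠ 0 := by rintro rfl; simp at hz
  induction k with
  | zero => simp [fundSol]
  | succ k ih =>
    have h := congrArg (fun M => z⁻¹ • M) (hQ.darboux k (hQ.isUnit_add hz.le))
    beta_reduce at h
    rw [← Matrix.smul_mul, ← Matrix.mul_smul, smul_add, smul_add, smul_smul, smul_smul, smul_smul,
      inv_mul_cancel₀ hz0, one_smul, mul_comm z⁻¹] at h
    rw [fundSol, Matrix.mul_assoc, ih, ← Matrix.mul_assoc, h, Matrix.mul_assoc, pow_succ']

/-- The inverse of the lower right block of `W_0`, where `z I + β` is invertible. -/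
def lowerInv (Q : Quadruple n m₁ m₂) (z : ℂ) : Matrix (Fin m₂) (Fin m₂) ℂ :=
  1 + Complex.I • (Q.ϑ₂ᴴ * (Q.S₀⁻¹ * ((z • (1 : Matrix (Fin n) (Fin n) ℂ) + Q.β)⁻¹ * Q.ϑ₂)))

theorem transfer_zero_mul_fromRows {z : ℂ} {p : ℕ} (G : Matrix (Fin m₂) (Fin p) ℂ) :
    Q.transfer 0 z * Matrix.fromRows (0 : Matrix (Fin m₁) (Fin p) ℂ) G = Matrix.fromRows
      (-Complex.I • (Q.ϑ₁ᴴ * (Q.S₀⁻¹ *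
        ((z • (1 : Matrix (Fin n) (Fin n) ℂ) + Q.α)⁻¹ * (Q.ϑ₂ * G)))))
      (G - Complex.I • (Q.ϑ₂ᴴ * (Q.S₀⁻¹ *
        ((z • (1 : Matrix (Fin n) (Fin n) ℂ) + Q.α)⁻¹ * (Q.ϑ₂ * G))))) := by
  have hL : Q.Λ 0 * Matrix.fromRows (0 : Matrix (Fin m₁) (Fin p) ℂ) G = Q.ϑ₂ * G := by
    rw [Λ, Matrix.fromCols_mul_fromRows, Matrix.mul_zero, zero_add]
  rw [transfer, Matrix.sub_mul, Matrix.one_mul, Matrix.smul_mul, Matrix.mul_assoc,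
    Matrix.mul_assoc, Matrix.mul_assoc, hL, Λ,
    Matrix.conjTranspose_fromCols_eq_fromRows_conjTranspose, Matrix.fromRows_mul]
  ext (i | i) j <;> simp [S]

/-- Passing from `α` to `β` is the state-space form of inverting the lower right block of `W_0`.
Thus `φ` is the quotient of the upper right block by the lower right one. -/
theorem transfer_zero_mul_lowerInv {z : ℂ}
    (hα : IsUnit (z • (1 : Matrix (Fin n) (Fin n) ℂ) + Q.α))
    (hβ : IsUnit (z • (1 : Matrix (Fin n) (Fin n) ℂ) + Q.β)) :
    Q.transfer 0 z * Matrix.fromRows (0 : Matrix (Fin m₁) (Fin m₂) ℂ) (Q.lowerInv z) = weylColumn (Q.φ z) := by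
  have r1 := Matrix.nonsing_inv_mul _ ((Matrix.isUnit_iff_isUnit_det _).1 hα)
  have r2 := Matrix.mul_nonsing_inv _ ((Matrix.isUnit_iff_isUnit_det _).1 hβ)
  have key : (z • (1 : Matrix (Fin n) (Fin n) ℂ) + Q.α)⁻¹ * (Q.ϑ₂ * Q.lowerInv z) =
      (z • (1 : Matrix (Fin n) (Fin n) ℂ) + Q.β)⁻¹ * Q.ϑ₂ := by
    have e : Q.ϑ₂ * Q.lowerInv z = (z • (1 : Matrix (Fin n) (Fin n) ℂ) + Q.α) *
        ((z • (1 : Matrix (Fin n) (Fin n) ℂ) + Q.β)⁻¹ * Q.ϑ₂) := by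
      have hαβ : z • (1 : Matrix (Fin n) (Fin n) ℂ) + Q.α =
          (z • (1 : Matrix (Fin n) (Fin n) ℂ) + Q.β) +
            Complex.I • (Q.ϑ₂ * Q.ϑ₂ᴴ * Q.S₀⁻¹) := by rw [β]; abel
      rw [hαβ, Matrix.add_mul, ← Matrix.mul_assoc, r2, Matrix.one_mul, lowerInv, Matrix.mul_add,
        Matrix.mul_one]
      simp only [Matrix.mul_smul, Matrix.smul_mul, Matrix.mul_assoc]
    rw [e, ← Matrix.mul_assoc, r1, Matrix.one_mul]
  rw [transfer_zero_mul_fromRows, key, φ, lowerInv, weylColumn]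
  simp only [Matrix.mul_assoc, add_sub_cancel_right]

theorem norm_one_sub_I_mul_inv_lt {z : ℂ} (hz : 1 / 2 < z.im) : ‖1 - Complex.I * z⁻¹‖ < 1 := by
  have hz0 : z ≠ 0 := by rintro rfl; norm_num at hz
  have h : 1 - Complex.I * z⁻¹ = (z - Complex.I) / z := by field_simp
  rw [h, norm_div, div_lt_one (norm_pos_iff.2 hz0),
    ← pow_lt_pow_iff_left₀ (norm_nonneg _) (norm_nonneg _) two_ne_zero, Complex.sq_norm,
    Complex.sq_norm, Complex.normSq_apply, Complex.normSq_apply]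
  simp
  nlinarith

theorem one_le_norm_one_add_I_mul_inv {z : ℂ} (hz : 0 < z.im) : 1 ≤ ‖1 + Complex.I * z⁻¹‖ := by
  have hz0 : z ≠ 0 := by rintro rfl; simp at hz
  have h : 1 + Complex.I * z⁻¹ = (z + Complex.I) / z := by field_simp
  rw [h, norm_div, one_le_div (norm_pos_iff.2 hz0),
    ← pow_le_pow_iff_left₀ (norm_nonneg _) (norm_nonneg _) two_ne_zero, Complex.sq_norm,
    Complex.sq_norm, Complex.normSq_apply, Complex.normSq_apply]
  simp
  nlinarith

/-- `φ` satisfies the summability condition wherever it is defined in `Im z > 1/2`. -/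
theorem StronglyAdmissible.weylSummable_φ (hQ : Q.StronglyAdmissible) {z : ℂ}
    (hz : 1 / 2 < z.im) (hβ : IsUnit (z • (1 : Matrix (Fin n) (Fin n) ℂ) + Q.β)) :
    WeylSummable Q.potential z (Q.φ z) := by
  have hz' : 0 < z.im := by linarith
  rw [weylSummable_iff]
  set r := ‖1 - Complex.I * z⁻¹‖ with hr
  have hr1 : r < 1 := norm_one_sub_I_mul_inv_lt hz
  set K := ‖Matrix.fromRows (0 : Matrix (Fin m₁) (Fin m₂) ℂ) (Q.lowerInv z)‖
  have hbound : ∀ k, ‖fundSol Q.potential z k *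
      weylColumn (Q.φ z)‖ ≤ r ^ k * K := by
    intro k
    rw [← transfer_zero_mul_lowerInv (hQ.isUnit_add hz'.le) hβ, ← Matrix.mul_assoc,
      hQ.fundSol_mul_transfer hz', Matrix.mul_assoc, signature_step_pow]
    have e : Matrix.fromRows ((1 + Complex.I * z⁻¹) ^ k • (0 : Matrix (Fin m₁) (Fin m₂) ℂ))
        ((1 - Complex.I * z⁻¹) ^ k • Q.lowerInv z) =
        (1 - Complex.I * z⁻¹) ^ k • Matrix.fromRows (0 : Matrix (Fin m₁) (Fin m₂) ℂ) (Q.lowerInv z) := by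
      ext (i | i) j <;> simp
    refine (hQ.norm_transfer_mul_le k hz' _).trans ?_
    rw [e, norm_smul, norm_pow]
  refine Summable.of_norm_bounded (g := fun k => (r ^ 2) ^ k * K ^ 2)
    ((summable_geometric_of_lt_one (by positivity)
      (pow_lt_one₀ (norm_nonneg _) hr1 two_ne_zero)).mul_right _) fun k => ?_
  refine (Matrix.frobenius_norm_mul _ _).trans ?_
  rw [Matrix.frobenius_norm_conjTranspose, ← pow_two]
  refine (pow_le_pow_left₀ (norm_nonneg _) (hbound k) 2).trans_eq ?_
  ring

/-- Far up in the half-plane only the value of `φ` satisfies the summability condition. -/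
theorem StronglyAdmissible.eq_φ_of_weylSummable (hQ : Q.StronglyAdmissible) {z : ℂ}
    (hz : 0 < z.im) (hzα : 4 * Q.α.trace.im ≤ z.im)
    (hβ : IsUnit (z • (1 : Matrix (Fin n) (Fin n) ℂ) + Q.β))
    {V : Matrix (Fin m₁) (Fin m₂) ℂ} (hV : WeylSummable Q.potential z V) : V = Q.φ z := by
  have hW : IsUnit (Q.transfer 0 z) := by
    rw [Matrix.isUnit_iff_isUnit_det, isUnit_iff_ne_zero]
    intro hdet
    obtain ⟨v, hv, hv0⟩ := Matrix.exists_mulVec_eq_zero_iff.2 hdet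
    -- A kernel vector, viewed as a one-column matrix, violates the lower bound on `W_0`.
    have := hQ.norm_le_two_mul_norm_transfer_mul 0 hz hzα (Matrix.replicateCol (Fin 1) v)
    rw [← Matrix.replicateCol_mulVec, hv0] at this
    have h0 : Matrix.replicateCol (Fin 1) v = 0 := by
      rw [← norm_le_zero_iff]; simpa using this
    exact hv (by simpa using h0)
  set G := (Q.transfer 0 z)⁻¹ * weylColumn V with hG
  have hWG : Q.transfer 0 z * G = weylColumn V := by
    rw [hG, ← Matrix.mul_assoc,
      Matrix.mul_nonsing_inv _ ((Matrix.isUnit_iff_isUnit_det _).1 hW), Matrix.one_mul]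
  obtain ⟨G₁, G₂, hG12⟩ : ∃ G₁ G₂, G = Matrix.fromRows G₁ G₂ :=
    ⟨G.toRows₁, G.toRows₂, (Matrix.fromRows_toRows G).symm⟩
  rw [hG12] at hWG
  have hlim := hV.tendsto_zero
  have hG1 : G₁ = 0 := by
    ext i j
    -- The upper block is multiplied by `(1 + i/z)^k`, of modulus at least one, and `W_k` loses at
    -- most a factor two. Hence `G₁` is dominated by a null sequence.
    have hle : ∀ k, ‖G₁ i j‖ ≤ 2 * ‖fundSol Q.potential z k *
        weylColumn V‖ := by
      intro k
      rw [← hWG, ← Matrix.mul_assoc, hQ.fundSol_mul_transfer hz, Matrix.mul_assoc,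
        signature_step_pow]
      refine le_trans ?_ (hQ.norm_le_two_mul_norm_transfer_mul k hz hzα _)
      refine le_trans ?_ (norm_apply_le_frobenius _ (Sum.inl i) j)
      simp only [Matrix.fromRows_apply_inl, Matrix.smul_apply, norm_smul, norm_pow]
      exact le_mul_of_one_le_left (norm_nonneg _)
        (one_le_pow₀ (one_le_norm_one_add_I_mul_inv hz))
    have := ge_of_tendsto' (hlim.const_mul 2) hle
    simpa using this
  rw [hG1] at hWG
  have hφ := transfer_zero_mul_lowerInv (hQ.isUnit_add hz.le) hβ
  rw [transfer_zero_mul_fromRows, weylColumn] at hWG hφ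
  obtain ⟨a1, a2⟩ := Matrix.fromRows_inj hWG
  obtain ⟨b1, b2⟩ := Matrix.fromRows_inj hφ
  have hd : ∀ G : Matrix (Fin m₂) (Fin m₂) ℂ, G - Complex.I • (Q.ϑ₂ᴴ * (Q.S₀⁻¹ *
        ((z • (1 : Matrix (Fin n) (Fin n) ℂ) + Q.α)⁻¹ * (Q.ϑ₂ * G)))) =
      (1 - Complex.I • (Q.ϑ₂ᴴ * (Q.S₀⁻¹ *
        ((z • (1 : Matrix (Fin n) (Fin n) ℂ) + Q.α)⁻¹ * Q.ϑ₂)))) * G := by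
    intro G
    simp only [Matrix.sub_mul, Matrix.one_mul, Matrix.smul_mul, Matrix.mul_assoc]
  rw [hd] at a2 b2
  have hGG : G₂ = Q.lowerInv z := by
    rw [← Matrix.inv_eq_right_inv a2, Matrix.inv_eq_right_inv b2]
  rw [← a1, ← b1, hGG]

end Quadruple
end SkewDirac

/-! ### Meromorphy of `φ` and uniqueness by the identity theorem. -/

namespace SkewDirac

open Filter Topology

theorem differentiable_det {n : ℕ} {A : ℂ → Matrix (Fin n) (Fin n) ℂ}
    (hA : ∀ i j, Differentiable ℂ fun z => A z i j) : Differentiable ℂ fun z => (A z).det := by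
  simp only [Matrix.det_apply']
  fun_prop

theorem differentiable_smul_one_add_apply {n : ℕ} (B : Matrix (Fin n) (Fin n) ℂ) (i j : Fin n) :
    Differentiable ℂ fun z : ℂ => (z • (1 : Matrix (Fin n) (Fin n) ℂ) + B) i j := by
  simp only [Matrix.add_apply, Matrix.smul_apply, smul_eq_mul]
  fun_prop

theorem differentiable_adjugate {n : ℕ} (B : Matrix (Fin n) (Fin n) ℂ) (i j : Fin n) :
    Differentiable ℂ fun z : ℂ => (z • (1 : Matrix (Fin n) (Fin n) ℂ) + B).adjugate i j := by
  simp only [Matrix.adjugate_apply]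
  refine differentiable_det fun a b => ?_
  by_cases h : a = j
  · subst h; simp
  · simp only [Matrix.updateRow_ne h]
    exact differentiable_smul_one_add_apply B a b

theorem finite_not_isUnit {n : ℕ} (B : Matrix (Fin n) (Fin n) ℂ) :
    {z : ℂ | ¬ IsUnit (z • (1 : Matrix (Fin n) (Fin n) ℂ) + B)}.Finite := by
  refine ((-B).charpoly.roots.toFinset.finite_toSet).subset fun z hz => ?_
  have hz' : ¬ IsUnit (z • (1 : Matrix (Fin n) (Fin n) ℂ) + B) := hz
  rw [Matrix.isUnit_iff_isUnit_det, isUnit_iff_ne_zero, not_not] at hz'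
  simp only [Finset.mem_coe, Multiset.mem_toFinset]
  rw [Polynomial.mem_roots (Matrix.charpoly_monic _).ne_zero, Polynomial.IsRoot,
    Matrix.eval_charpoly, sub_neg_eq_add, ← hz']
  congr 2
  ext i j
  simp [Matrix.scalar_apply, Matrix.diagonal_apply, Matrix.one_apply]

namespace Quadruple

variable {n m₁ m₂ : ℕ} {Q : Quadruple n m₁ m₂}

theorem φ_apply (z : ℂ) (i : Fin m₁) (j : Fin m₂) :
    Q.φ z i j = ((z • (1 : Matrix (Fin n) (Fin n) ℂ) + Q.β).det)⁻¹ *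
      ∑ b, (∑ a, -Complex.I * (Q.ϑ₁ᴴ * Q.S₀⁻¹) i a *
        (z • (1 : Matrix (Fin n) (Fin n) ℂ) + Q.β).adjugate a b) * Q.ϑ₂ b j := by
  rw [φ, Matrix.inv_def (z • 1 + Q.β), Ring.inverse_eq_inv', Matrix.mul_smul, Matrix.smul_mul, smul_comm,
    Matrix.smul_apply, smul_eq_mul, ← Matrix.smul_mul, ← Matrix.smul_mul, Matrix.mul_apply]
  simp only [Matrix.mul_apply, Matrix.smul_apply, smul_eq_mul]

theorem meromorphicAt_φ (i : Fin m₁) (j : Fin m₂) (z : ℂ) :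
    MeromorphicAt (fun w => Q.φ w i j) z := by
  simp only [φ_apply]
  have h1 := differentiable_det (differentiable_smul_one_add_apply Q.β)
  have h2 := differentiable_adjugate Q.β
  refine (h1.analyticAt z).meromorphicAt.inv.mul ?_
  refine (Differentiable.analyticAt ?_ z).meromorphicAt
  fun_prop

theorem regularAt_φ {z : ℂ} (hz : IsUnit (z • (1 : Matrix (Fin n) (Fin n) ℂ) + Q.β)) :
    RegularAt Q.φ z := by
  intro i j
  simp only [φ_apply]
  have h1 := differentiable_det (differentiable_smul_one_add_apply Q.β)
  have h2 := differentiable_adjugate Q.β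
  refine ((h1.analyticAt z).inv ?_).mul (Differentiable.analyticAt ?_ z)
  · exact ((Matrix.isUnit_iff_isUnit_det _).1 hz).ne_zero
  · fun_prop

/-- Above some height `z I + β` is invertible. -/
theorem exists_forall_isUnit (Q : Quadruple n m₁ m₂) :
    ∃ M : ℝ, ∀ z : ℂ, M < z.im → IsUnit (z • (1 : Matrix (Fin n) (Fin n) ℂ) + Q.β) := by
  obtain ⟨M, hM⟩ := ((finite_not_isUnit Q.β).image Complex.im).bddAbove
  refine ⟨M, fun z hz => ?_⟩
  by_contra h
  exact absurd (hM ⟨z, h, rfl⟩) (not_le.2 hz)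

theorem StronglyAdmissible.exists_isWeylFunctionOn (hQ : Q.StronglyAdmissible) :
    ∃ M : ℝ, IsWeylFunctionOn Q.potential M Q.φ := by
  obtain ⟨M, hM⟩ := Q.exists_forall_isUnit
  -- The `1` makes the height positive and keeps the half-plane above `1/2`.
  refine ⟨max M 1, by positivity, fun i j z _ => meromorphicAt_φ i j z, fun z hz _ => ?_⟩
  rw [max_lt_iff] at hz
  exact hQ.weylSummable_φ (by linarith [hz.2]) (hM z hz.1)

/-- Pointwise uniqueness is available only high up. There `ψ - φ` vanishes near a point off the
point itself, so its meromorphic order is infinite, and this spreads over the connected half-plane.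
-/
theorem StronglyAdmissible.eq_φ_of_isWeylFunctionOn (hQ : Q.StronglyAdmissible) {M : ℝ}
    {ψ : ℂ → Matrix (Fin m₁) (Fin m₂) ℂ} (hψ : IsWeylFunctionOn Q.potential M ψ) {z : ℂ}
    (hz : M < z.im) (hr : RegularAt ψ z)
    (hβ : IsUnit (z • (1 : Matrix (Fin n) (Fin n) ℂ) + Q.β)) : ψ z = Q.φ z := by
  obtain ⟨hM, hmer, hsum⟩ := hψ
  obtain ⟨N, hN⟩ := Q.exists_forall_isUnit
  have hopen : IsOpen {w : ℂ | M < w.im} := isOpen_lt continuous_const Complex.continuous_im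
  have hconn : IsConnected {w : ℂ | M < w.im} :=
    ⟨⟨z, hz⟩, (convex_halfSpace_im_gt M).isPreconnected⟩
  set Y := max M (max N (4 * Q.α.trace.im)) with hY
  have hYopen : IsOpen {w : ℂ | Y < w.im} := isOpen_lt continuous_const Complex.continuous_im
  ext i j
  have hf : MeromorphicOn (fun w => ψ w i j - Q.φ w i j) {w : ℂ | M < w.im} := fun w hw =>
    (hmer i j w hw).sub (meromorphicAt_φ i j w)
  let z₁ : ℂ := ⟨0, Y + 1⟩
  have hz₁ : Y < z₁.im := by simp [z₁]
  have hMz₁ : M < z₁.im := (le_max_left _ _).trans_lt hz₁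
  have htop : meromorphicOrderAt (fun w => ψ w i j - Q.φ w i j) z₁ = ⊤ := by
    rw [meromorphicOrderAt_eq_top_iff]
    have hreg : ∀ᶠ w in 𝓝[≠] z₁, RegularAt ψ w := by
      simp only [RegularAt, eventually_all]
      exact fun a b => (hmer a b z₁ hMz₁).eventually_analyticAt
    filter_upwards [hreg, nhdsWithin_le_nhds (hYopen.mem_nhds hz₁)] with w hw hwY
    simp only [hY, max_lt_iff] at hwY
    have := hQ.eq_φ_of_weylSummable (hM.trans hwY.1) hwY.2.2.le (hN w hwY.2.1)
      (hsum w hwY.1 hw)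
    rw [this, sub_self]
  have hztop : meromorphicOrderAt (fun w => ψ w i j - Q.φ w i j) z = ⊤ := by
    by_contra hne
    exact (hf.exists_meromorphicOrderAt_ne_top_iff_forall hconn).1 ⟨⟨z, hz⟩, hne⟩ ⟨z₁, hMz₁⟩ htop
  rw [meromorphicOrderAt_eq_top_iff] at hztop
  -- Infinite order controls only punctured neighbourhoods; analyticity of both functions at `z`
  -- recovers the value there.
  have hcont : ContinuousAt (fun w => ψ w i j - Q.φ w i j) z :=
    ((hr i j).sub (regularAt_φ hβ i j)).continuousAt
  have hlim := hcont.tendsto.mono_left (nhdsWithin_le_nhds (s := {z}ᶜ))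
  have h0 : Tendsto (fun w => ψ w i j - Q.φ w i j) (𝓝[≠] z) (𝓝 0) :=
    tendsto_const_nhds.congr' (hztop.mono fun w hw => hw.symm)
  exact sub_eq_zero.1 (tendsto_nhds_unique hlim h0)

end Quadruple
end SkewDirac

end

theorem theorem3p7 {n m₁ m₂ : ℕ} (Q : SkewDirac.Quadruple n m₁ m₂)
    (hQ : Q.StronglyAdmissible) :
    -- the potential is well defined and is the potential of a discrete Dirac system
    IsUnit Q.α ∧ (∀ k, (Q.S k).PosDef) ∧ SkewDirac.IsDiracPotential Q.potential ∧
    -- `φ` is a Weyl function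
    (∃ M : ℝ, SkewDirac.IsWeylFunctionOn Q.potential M Q.φ) ∧
    -- every Weyl function, on any half-plane, coincides with `φ` as a meromorphic function
    (∀ (M : ℝ) (ψ : ℂ → Matrix (Fin m₁) (Fin m₂) ℂ),
      SkewDirac.IsWeylFunctionOn Q.potential M ψ →
      ∀ z : ℂ, M < z.im → SkewDirac.RegularAt ψ z →
        IsUnit (z • (1 : Matrix (Fin n) (Fin n) ℂ) + Q.β) → ψ z = Q.φ z) ∧
    -- `φ` is defined and satisfies the summability condition on `Im z > 1/2`,
    -- apart from finitely many points
    (∃ F : Set ℂ, F.Finite ∧ ∀ z : ℂ, 1 / 2 < z.im → z ∉ F →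
      IsUnit (z • (1 : Matrix (Fin n) (Fin n) ℂ) + Q.β) ∧
        SkewDirac.WeylSummable Q.potential z (Q.φ z)) := by
  refine ⟨hQ.isUnit_α, hQ.posDef_S, hQ.isDiracPotential, hQ.exists_isWeylFunctionOn,
    fun M ψ hψ z hz hr hβ => hQ.eq_φ_of_isWeylFunctionOn hψ hz hr hβ,
    _, SkewDirac.finite_not_isUnit Q.β, fun z hz hF => ?_⟩
  have hβ := not_not.1 hF
  exact ⟨hβ, hQ.weylSummable_φ hz hβ⟩
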